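/- Let $\mathcal S,\mathcal A,\mathcal I$ be finite sets with $\mathcal A\neq\emptyset$, let $H$ be the horizon, and number the stages $h=0,1,\dots,H-1$. Let $\alpha$ be a probability distribution on $\mathcal S$, $r_h:\mathcal S\times\mathcal A\to[0,1]$ rewards, $\widehat P_h(\cdot\mid x,a)$ a reference transition probability function, $w_{h,i}:\mathcal S\to\mathbb R$ constraint-aggregation functions and $b_{h,i}:\mathcal S\times\mathcal A\to[0,\infty)$ confidence widths, $i\in\mathcal I$ (the case in which none of them depends on $h$ is included). The primal optimistic linear program is to maximize $\sum_{h,x,a,x'}q_h(x,a,x')r_h(x,a)$ over $q\ge0$, $\varepsilon\ge0$ subject to $$\sum_{a,x'}q_0(x,a,x')=\alpha(x),\qquad \sum_{a,x'}q_h(x,a,x')=\sum_{z,a}q_{h-1}(z,a,x)\quad(1\le h\le H-1),$$ $$\Bigl|q_h(x,a,x')-\widehat P_h(x'\mid x,a)\sum_y q_h(x,a,y)\Bigr|\le\varepsilon_h(x,a,x'),\qquad \sum_y w_{h,i}(y)\,\varepsilon_h(x,a,y)\le b_{h,i}(x,a)\sum_y q_h(x,a,y)$$ (the absolute value standing for two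 linear inequalities). Its dual is its Lagrangian linear-programming dual, with free multipliers $\beta_h(x)$, $0\le h\le H-1$, for the equality constraints and nonnegative multipliers for the inequalities other than $q,\varepsilon\ge 0$; put $\beta_H=0$. Then there are a bonus function $\mathrm{CB}:\mathcal S\times\mathcal A\times\{0,\dots,H-1\}\to\mathbb R_+$ and a function $\beta^*=(\beta^*_h)_{0\le h\le H}$ with $\beta^*_H=0$ such that the following holds. 1. The dual can be written as the optimistic Bellman linear program $$\text{minimize }\sum_x\alpha(x)\beta_0(x)\quad\text{subject to}\quad \beta_h(x)\ge r_h(x,a)+\mathrm{CB}_h(x,a)+\sum_y\widehat P_h(y\mid x,a)\beta_{h+1}(y)\ \ \forall x,a,h,\qquad \beta_H=0,$$ in the following sense. $\beta^*$ is an optimal solution of this program, and is its componentwise least feasible point; $\beta^*$ together with suitable values of the other multipliers is an optimal solution of the dual; the optimal values of the primal program, of its dual and of the Bellman program are attained and all equal to $\sum_x\alpha(x)\beta_0^*(x)$. Moreover $\mathrm{CB}_h(x,a)=B_h(\beta^*_{h+1})(x,a)$ for maps $B_h:\mathbb R^{\mathcal S}\to\mathbb R_+^{\mathcal S\times\mathcal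 A}$ such that a function $\beta$ with $\beta_H=0$ extends by suitable values of the other multipliers to a feasible point of the dual if and only if $\beta_h(x)\ge r_h(x,a)+B_h(\beta_{h+1})(x,a)+\sum_y\widehat P_h(y\mid x,a)\beta_{h+1}(y)$ for all $x,a,h$, and the dual objective is then $\sum_x\alpha(x)\beta_0(x)$. 2. Let $(q^*,\varepsilon^*)$ be any optimal solution of the primal program, and let $\pi^+_h(a\mid x)=\sum_{x'}q^*_h(x,a,x')/\sum_{a',x'}q^*_h(x,a',x')$ be the extracted policy, defined where the denominator is nonzero and arbitrary elsewhere. Whenever the denominator is nonzero and $\pi^+_h(a\mid x)>0$, $$\beta^*_h(x)=r_h(x,a)+\mathrm{CB}_h(x,a)+\sum_y\widehat P_h(y\mid x,a)\beta^*_{h+1}(y).$$ In particular there is a deterministic policy $\pi^+$ that plays only actions of positive probability at the states where the denominator is nonzero, and for which this equality with $a=\pi^+_h(x)$ holds for all $x\in\mathcal S$ and all $h$. 3. If the true transition function $P$ satisfies $\sum_{y}w_{h,i}(y)\,|P_h(y\mid x,a)-\widehat P_h(y\mid x,a)|\le b_{h,i}(x,a)$ for all $h,i,x,a$, then $V^*_h(x)\le\beta^*_h(x)\le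 H-h$ for all $x\in\mathcal S$ and $0\le h\le H$, where $V^*_h(x)$ is the maximum over deterministic policies of the expected total reward under $P$ collected in stages $h,\dots,H-1$ from $x$. -/

import Mathlib

/-!
For a fixed stage, state and action the confidence constraints define a polyhedral cone of pairs
`(q, ε)`, whose slice of mass one is a set of distributions around the reference distribution.
Summation by parts along the stages makes the Lagrangian a linear function of `(q, ε)` whose
coefficients couple the stages only through `β`. By Farkas' lemma the remaining multipliers can
be chosen at `(h, x, a)` if and only if `β_h(x) - r_h(x, a)` is at least the largest expectation of
`β_{h+1}` over that slice, so the bonus is the excess of this largest expectation over the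
reference expectation.

Backward induction with these backups produces `β*`, and monotonicity of the backups makes it the
least supersolution and compares it with the value functions. The occupancy measure of a greedy
policy under maximizing distributions has total reward `∑ α(x) β*_0(x)`. The duality gap of a
feasible `(q, ε)` and a supersolution `β` is at least the sum of the masses of `q` times the slacks
of `β` in the Bellman inequalities, which gives weak duality and complementary slackness.
-/

/-- A stage-dependent transition function on finite `S`, `A`, with stages `0, …, H - 1`:
`P h x a y` is the probability of moving from `x` to `y` under action `a` in stage `h`. -/
structure IsTransition {S A : Type*} [Fintype S] {H : ℕ} (P : Fin H → S → A → S → ℝ) : Prop where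
  nonneg : ∀ h x a y, 0 ≤ P h x a y
  sum_one : ∀ h x a, ∑ y, P h x a y = 1

/-- The data of the optimistic planning problem: initial distribution `α`, rewards `r` in `[0,1]`,
reference transition function `Phat`, constraint-aggregation functions `w` and nonnegative
confidence widths `b`, indexed by `I`. Stages are numbered `0, …, H - 1`. -/
structure OptimisticModel (S A I : Type*) [Fintype S] (H : ℕ) where
  α : S → ℝ
  r : Fin H → S → A → ℝ
  Phat : Fin H → S → A → S → ℝ
  w : Fin H → I → S → ℝ
  b : Fin H → I → S → A → ℝ
  α_nonneg : ∀ x, 0 ≤ α x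
  α_sum : ∑ x, α x = 1
  r_nonneg : ∀ h x a, 0 ≤ r h x a
  r_le_one : ∀ h x a, r h x a ≤ 1
  Phat_transition : IsTransition Phat
  b_nonneg : ∀ h i x a, 0 ≤ b h i x a

/-- Lagrange multipliers of the primal program: `β` for the initial and flow equalities,
`μp` and `μm` for the two families of deviation inequalities, `μ` for the aggregated
confidence inequalities. -/
structure Multipliers (S A I : Type*) (H : ℕ) where
  β : Fin H → S → ℝ
  μp : Fin H → S → A → S → ℝ
  μm : Fin H → S → A → S → ℝ
  μ : Fin H → I → S → A → ℝ

namespace Multipliers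

/-- The multipliers of the inequality constraints are nonnegative; `β` is free. -/
structure Nonneg {S A I : Type*} {H : ℕ} (m : Multipliers S A I H) : Prop where
  μp : ∀ h x a y, 0 ≤ m.μp h x a y
  μm : ∀ h x a y, 0 ≤ m.μm h x a y
  μ : ∀ h i x a, 0 ≤ m.μ h i x a

end Multipliers

namespace OptimisticModel

variable {S A I : Type*} [Fintype S] [Fintype A] [Fintype I] {H : ℕ}

/-- Mass of `q h` at the state `x`. -/
def outflow (q : Fin H → S → A → S → ℝ) (h : Fin H) (x : S) : ℝ :=
  ∑ a, ∑ y, q h x a y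

/-- Mass that has to be at `x` in stage `h`: the initial distribution if `h = 0`, and what stage
`h - 1` sends to `x` otherwise. -/
def inflow (M : OptimisticModel S A I H) (q : Fin H → S → A → S → ℝ) (h : Fin H) (x : S) : ℝ :=
  if (h : ℕ) = 0 then M.α x
  else ∑ z, ∑ a, q ⟨(h : ℕ) - 1, lt_of_le_of_lt (Nat.sub_le _ _) h.isLt⟩ z a x

/-- The total reward of `q`. -/
def primalObj (M : OptimisticModel S A I H) (q : Fin H → S → A → S → ℝ) : ℝ :=
  ∑ h, ∑ x, ∑ a, ∑ y, q h x a y * M.r h x a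

/-- Feasibility in the primal optimistic linear program: `q` lies in the flow polytope, `ε ≥ 0`,
and the deviation and aggregated confidence constraints hold. -/
structure PrimalFeasible (M : OptimisticModel S A I H) (q ε : Fin H → S → A → S → ℝ) : Prop where
  q_nonneg : ∀ h x a y, 0 ≤ q h x a y
  ε_nonneg : ∀ h x a y, 0 ≤ ε h x a y
  flow : ∀ h x, outflow q h x = M.inflow q h x
  dev_pos : ∀ h x a y, q h x a y - M.Phat h x a y * ∑ z, q h x a z ≤ ε h x a y
  dev_neg : ∀ h x a y, M.Phat h x a y * ∑ z, q h x a z - q h x a y ≤ ε h x a y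
  conf : ∀ h i x a, ∑ y, M.w h i y * ε h x a y ≤ M.b h i x a * ∑ y, q h x a y

/-- `(q, ε)` is an optimal solution of the primal optimistic linear program. -/
def PrimalOptimal (M : OptimisticModel S A I H) (q ε : Fin H → S → A → S → ℝ) : Prop :=
  M.PrimalFeasible q ε ∧ ∀ q' ε', M.PrimalFeasible q' ε' → M.primalObj q' ≤ M.primalObj q

/-- The Lagrangian of the primal program (a maximization over `q, ε ≥ 0`). -/
def lagrangian (M : OptimisticModel S A I H) (q ε : Fin H → S → A → S → ℝ)
    (m : Multipliers S A I H) : ℝ :=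
  M.primalObj q
    + ∑ h, ∑ x, m.β h x * (M.inflow q h x - outflow q h x)
    + ∑ h, ∑ x, ∑ a, ∑ y,
        m.μp h x a y * (ε h x a y - (q h x a y - M.Phat h x a y * ∑ z, q h x a z))
    + ∑ h, ∑ x, ∑ a, ∑ y,
        m.μm h x a y * (ε h x a y - (M.Phat h x a y * ∑ z, q h x a z - q h x a y))
    + ∑ h, ∑ i, ∑ x, ∑ a,
        m.μ h i x a * (M.b h i x a * ∑ y, q h x a y - ∑ y, M.w h i y * ε h x a y)

/-- `m` is feasible in the dual linear program of the primal program, with dual objective `v`: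
the inequality multipliers are nonnegative and the dual function
`sup {lagrangian q ε m | q, ε ≥ 0}` is finite and equal to `v`. The dual program is to
minimize this `v`. -/
def IsDualValue (M : OptimisticModel S A I H) (m : Multipliers S A I H) (v : ℝ) : Prop :=
  m.Nonneg ∧
    IsLUB {l : ℝ | ∃ q ε : Fin H → S → A → S → ℝ, (∀ h x a y, 0 ≤ q h x a y) ∧
      (∀ h x a y, 0 ≤ ε h x a y) ∧ l = M.lagrangian q ε m} v

/-- The objective `∑ α(x) β₀(x)`. -/
def initialValue (M : OptimisticModel S A I H) (β : Fin (H + 1) → S → ℝ) : ℝ :=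
  ∑ x, M.α x * β 0 x

/-- The right-hand side `r + c + P̂ v` of a Bellman inequality, where `c` is the bonus. -/
def backup (M : OptimisticModel S A I H) (h : Fin H) (x : S) (a : A) (c : ℝ) (v : S → ℝ) : ℝ :=
  M.r h x a + c + ∑ y, M.Phat h x a y * v y

/-- Feasibility in the optimistic Bellman linear program with bonus function `CB`;
`β` has the terminal value `0` after the last stage. -/
def BellmanFeasible (M : OptimisticModel S A I H) (CB : Fin H → S → A → ℝ)
    (β : Fin (H + 1) → S → ℝ) : Prop :=
  (∀ x, β (Fin.last H) x = 0) ∧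
    ∀ h x a, M.backup h x a (CB h x a) (β h.succ) ≤ β h.castSucc x

/-- The stochastic policy induced by `q`: the probability of action `a` in state `x`, stage `h`
(equal to `0` for all `a` if `x` carries no mass in stage `h`, where the policy is not
determined by `q`). -/
noncomputable def inducedPolicy (q : Fin H → S → A → S → ℝ) (h : Fin H) (x : S) (a : A) : ℝ :=
  (∑ y, q h x a y) / outflow q h x

/-- A deterministic policy is extracted from `q` if in every stage and in every state of positive
mass it plays an action that the induced stochastic policy plays with positive probability.
It is arbitrary at the other states. -/
def IsExtracted (q : Fin H → S → A → S → ℝ) (π : Fin H → S → A) : Prop :=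
  ∀ h x, 0 < outflow q h x → 0 < inducedPolicy q h x (π h x)

/-- The transition function `P` satisfies the aggregated confidence constraints around `Phat`. -/
def InConfidenceSet (M : OptimisticModel S A I H) (P : Fin H → S → A → S → ℝ) : Prop :=
  ∀ h i x a, ∑ y, M.w h i y * |P h x a y - M.Phat h x a y| ≤ M.b h i x a

end OptimisticModel

section Values

variable {S A : Type*} [Fintype S] {H : ℕ}

/-- The stage that is `k` steps after stage `h`. -/
def stageAfter (h : Fin (H + 1)) (k : Fin (H - (h : ℕ))) : Fin H :=
  ⟨(h : ℕ) + (k : ℕ), by have := k.isLt; omega⟩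

/-- Value function of the policy `π` under the transition function `P`: the expected total reward
from stage `h` on, given that the state in stage `h` is `x`. The expectation is the sum over all
sequences `ω` of subsequent states of the probability of the trajectory `x, ω₀, ω₁, …` times the
reward collected on it. -/
def policyValue (P : Fin H → S → A → S → ℝ) (r : Fin H → S → A → ℝ) (π : Fin H → S → A)
    (h : Fin (H + 1)) (x : S) : ℝ :=
  ∑ ω : Fin (H - (h : ℕ)) → S,
    let s : Fin (H - (h : ℕ) + 1) → S := Fin.cons x ω
    (∏ k, P (stageAfter h k) (s k.castSucc) (π (stageAfter h k) (s k.castSucc)) (s k.succ)) *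
      ∑ k, r (stageAfter h k) (s k.castSucc) (π (stageAfter h k) (s k.castSucc))

/-- The optimal value function: the maximum of the values of all (finitely many) policies. -/
noncomputable def optimalValue (P : Fin H → S → A → S → ℝ) (r : Fin H → S → A → ℝ)
    (h : Fin (H + 1)) (x : S) : ℝ :=
  ⨆ π : Fin H → S → A, policyValue P r π h x

end Values

section LinearProgramming

open Module PointedCone

theorem hull_image_add_smul_le {R V ι : Type*} [Semiring R] [PartialOrder R] [IsOrderedRing R]
    [AddCommMonoid V] [Module R V] {s : Set ι} {t : ι → R} (ht : ∀ i ∈ s, 0 ≤ t i) (a : ι → V)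
    (b : V) : hull R ((fun i => a i + t i • b) '' s) ≤ hull R (insert b (a '' s)) := by
  refine Submodule.span_le.2 ?_
  rintro _ ⟨i, hi, rfl⟩
  exact add_mem (subset_hull (Set.mem_insert_of_mem _ (Set.mem_image_of_mem a hi)))
    (PointedCone.smul_mem _ (ht i hi) (subset_hull (Set.mem_insert _ _)))

variable {𝕜 V ι : Type*} [Field 𝕜] [LinearOrder 𝕜] [IsStrictOrderedRing 𝕜] [AddCommGroup V]
  [Module 𝕜 V]

theorem mem_hull_image_of_forall_nonneg (s : Finset ι) (a : ι → Dual 𝕜 V) (c : Dual 𝕜 V)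
    (hc : ∀ x, (∀ i ∈ s, 0 ≤ a i x) → 0 ≤ c x) : c ∈ hull 𝕜 (a '' s) := by
  classical
  induction s using Finset.induction_on generalizing a c with
  | empty =>
    have hc0 : c = 0 := by
      ext x
      have hneg := hc (-x) (by simp)
      rw [map_neg, neg_nonneg] at hneg
      exact le_antisymm hneg (hc x (by simp))
    exact hc0 ▸ zero_mem _
  | insert j s _ ih =>
    rw [Finset.coe_insert, Set.image_insert_eq]
    by_cases hredundant : ∀ x, (∀ i ∈ s, 0 ≤ a i x) → 0 ≤ c x
    · exact Submodule.span_mono (Set.subset_insert _ _) (ih a c hredundant)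
    push Not at hredundant
    obtain ⟨z, hz, hcz⟩ := hredundant
    have hjz : a j z < 0 := by
      by_contra! hjz
      exact hcz.not_ge (hc z ((Finset.forall_mem_insert ..).2 ⟨hjz, hz⟩))
    -- Projecting along `z` onto the hyperplane `a j = 0` adds a multiple of `a j` to every
    -- functional, and `a j` drops out of the constraints.
    let t (f : Dual 𝕜 V) : 𝕜 := -(f z / a j z)
    have hproj (f : Dual 𝕜 V) (x : V) : (f + t f • a j) x = f (x - (a j x / a j z) • z) := by
      simp only [t, LinearMap.add_apply, LinearMap.smul_apply, map_sub, map_smul, smul_eq_mul]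
      ring
    have hmem : c + t c • a j ∈ hull 𝕜 ((fun i => a i + t (a i) • a j) '' s) := by
      refine ih _ _ fun x hx => ?_
      rw [hproj]
      refine hc _ ((Finset.forall_mem_insert ..).2 ⟨?_, fun i hi => ?_⟩)
      · simp [hjz.ne]
      · exact hproj (a i) x ▸ hx i hi
    have ht (i) (hi : i ∈ s) : 0 ≤ t (a i) :=
      neg_nonneg.2 (div_nonpos_of_nonneg_of_nonpos (hz i hi) hjz.le)
    have hc_eq : c + t c • a j + (c z / a j z) • a j = c := by
      simp only [t, add_assoc, ← add_smul, neg_add_cancel, zero_smul, add_zero]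
    exact hc_eq ▸ add_mem (hull_image_add_smul_le ht a (a j) hmem)
      (PointedCone.smul_mem _ (div_nonneg_of_nonpos hcz.le hjz.le)
        (subset_hull (Set.mem_insert _ _)))

theorem exists_nonneg_sum_smul_eq_of_forall_nonneg [Fintype ι] (a : ι → Dual 𝕜 V)
    (c : Dual 𝕜 V) (hc : ∀ x, (∀ i, 0 ≤ a i x) → 0 ≤ c x) :
    ∃ l : ι → 𝕜, 0 ≤ l ∧ ∑ i, l i • a i = c := by
  have hmem := mem_hull_image_of_forall_nonneg Finset.univ a c (by simpa using hc)
  rw [Finset.coe_univ, Set.image_univ] at hmem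
  obtain ⟨l, hl⟩ := (Submodule.mem_span_range_iff_exists_fun _).1 hmem
  exact ⟨fun i => l i, fun i => (l i).2, hl⟩

theorem exists_forall_one_le_mul_sub_of_forall_lt [Finite ι] {a : ι → Dual 𝕜 V}
    {e g : Dual 𝕜 V} {t : 𝕜} (hlt : ∀ x, (∀ i, 0 ≤ a i x) → e x = 1 → g x < t) :
    ∃ c : 𝕜, ∀ x, (∀ i, 0 ≤ a i x) → e x = 1 → 1 ≤ c * (t - g x) := by
  have := Fintype.ofFinite ι
  obtain ⟨l, hl, hsum⟩ := exists_nonneg_sum_smul_eq_of_forall_nonneg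
    (fun o : Option ι => o.elim (g - t • e) a) (-e) fun x hx => by
      rw [Option.forall] at hx
      by_contra! hpos
      have hex : 0 < e x := by simpa using hpos
      have hgx := hlt ((e x)⁻¹ • x)
        (fun i => by
          rw [map_smul]
          exact smul_nonneg (inv_nonneg.2 hex.le) (hx.2 i))
        (by rw [map_smul, smul_eq_mul, inv_mul_cancel₀ hex.ne'])
      rw [map_smul, smul_eq_mul, inv_mul_lt_iff₀ hex] at hgx
      have hle : 0 ≤ g x - t * e x := hx.1
      linarith
  refine ⟨l none, fun x hx hex => ?_⟩
  have heval := LinearMap.congr_fun hsum x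
  simp only [Fintype.sum_option, Option.elim, LinearMap.add_apply, LinearMap.sum_apply,
    LinearMap.smul_apply, LinearMap.sub_apply, LinearMap.neg_apply, smul_eq_mul, hex] at heval
  have hnonneg : 0 ≤ ∑ i, l (some i) * a i x :=
    Finset.sum_nonneg fun i _ => mul_nonneg (hl _) (hx i)
  linarith

theorem exists_isMaxOn_coneSlice {V ι : Type*} [AddCommGroup V] [Module ℝ V] [Finite ι]
    (a : ι → Dual ℝ V) (e g : Dual ℝ V) (hne : {x | (∀ i, 0 ≤ a i x) ∧ e x = 1}.Nonempty)
    (hbdd : BddAbove (g '' {x | (∀ i, 0 ≤ a i x) ∧ e x = 1})) :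
    ∃ x ∈ {x | (∀ i, 0 ≤ a i x) ∧ e x = 1}, IsMaxOn g {x | (∀ i, 0 ≤ a i x) ∧ e x = 1} x := by
  set X := {x | (∀ i, 0 ≤ a i x) ∧ e x = 1}
  set t := sSup (g '' X)
  have hle (x) (hx : x ∈ X) : g x ≤ t := le_csSup hbdd (Set.mem_image_of_mem g hx)
  by_contra! hmax
  have hlt (x) (hx : x ∈ X) : g x < t :=
    (hle x hx).lt_of_ne fun heq => hmax x hx fun y hy => heq ▸ hle y hy
  -- Strict inequality on the slice improves to a uniform gap, so `t` is not the supremum.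
  obtain ⟨c, hgap⟩ := exists_forall_one_le_mul_sub_of_forall_lt fun x hx hex => hlt x ⟨hx, hex⟩
  obtain ⟨x₀, hx₀⟩ := hne
  have hc : 0 < c :=
    pos_of_mul_pos_left (one_pos.trans_le (hgap x₀ hx₀.1 hx₀.2)) (sub_nonneg.2 (hle x₀ hx₀))
  obtain ⟨_, ⟨x, hx, rfl⟩, hxt⟩ := exists_lt_of_lt_csSup (Set.Nonempty.image g ⟨x₀, hx₀⟩)
    (sub_lt_self t (inv_pos.2 hc))
  have hsmall : c * (t - g x) < 1 := by
    rw [← lt_inv_mul_iff₀ hc, mul_one]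
    linarith
  exact (hgap x hx.1 hx.2).not_gt hsmall

theorem isLUB_image_const_add_dotProduct_iff [Fintype ι] (c : 𝕜) (f : ι → 𝕜) (v : 𝕜) :
    IsLUB ((fun z => c + z ⬝ᵥ f) '' Set.Ici 0) v ↔ v = c ∧ f ≤ 0 := by
  classical
  have hlub (hf : f ≤ 0) : IsLUB ((fun z => c + z ⬝ᵥ f) '' Set.Ici 0) c := by
    refine IsGreatest.isLUB ⟨⟨0, Set.self_mem_Ici, by simp⟩, ?_⟩
    rintro _ ⟨z, hz, rfl⟩
    simpa using dotProduct_le_dotProduct_of_nonneg_left hf hz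
  refine ⟨fun hv => ?_, fun ⟨hvc, hf⟩ => hvc ▸ hlub hf⟩
  have hf : f ≤ 0 := fun i => by
    by_contra! hi
    rw [Pi.zero_apply] at hi
    have hray (s : 𝕜) (hs : 0 ≤ s) : c + s * f i ≤ v :=
      hv.1 ⟨Pi.single i s, Pi.single_nonneg.2 hs, by simp⟩
    have hcv : c ≤ v := by simpa using hray 0 le_rfl
    have hlarge := hray ((v - c + 1) / f i) (div_nonneg (by linarith) hi.le)
    rw [div_mul_cancel₀ _ hi.ne'] at hlarge
    linarith
  exact ⟨hv.unique (hlub hf), hf⟩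

end LinearProgramming

/-- A reference distribution `center` with aggregation functions `w` and widths `b`, i.e. the
confidence constraints of an optimistic model at a single stage, state and action. -/
structure ConfidenceRegion (S I : Type*) where
  center : S → ℝ
  w : I → S → ℝ
  b : I → ℝ

/-- Multipliers of the constraints of a `ConfidenceRegion`: `μp` and `μm` for the two families of
deviation inequalities, `μ` for the aggregated inequalities. -/
structure ConfidenceMultipliers (S I : Type*) where
  μp : S → ℝ
  μm : S → ℝ
  μ : I → ℝ

namespace ConfidenceRegion

variable {S I : Type*} [Fintype S]

/-- The homogeneous confidence constraints on a measure `p` on `S` and bounds `ε` for its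
deviation from the reference distribution scaled to the mass of `p`. -/
structure Cone (C : ConfidenceRegion S I) (p ε : S → ℝ) : Prop where
  p_nonneg : ∀ y, 0 ≤ p y
  ε_nonneg : ∀ y, 0 ≤ ε y
  dev_pos : ∀ y, p y - C.center y * ∑ z, p z ≤ ε y
  dev_neg : ∀ y, C.center y * ∑ z, p z - p y ≤ ε y
  conf : ∀ i, ∑ y, C.w i y * ε y ≤ C.b i * ∑ y, p y

/-- The probability distributions of a confidence region: the slice of mass one of the cone. -/
def distributions (C : ConfidenceRegion S I) : Set (S → ℝ) :=
  {p | ∑ y, p y = 1 ∧ ∃ ε, C.Cone p ε}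

/-- The largest expectation of `v` under the distributions of `C`, which is attained by
`exists_dotProduct_eq_maxExpectation` if there are any (otherwise it is the junk value `0`). -/
noncomputable def maxExpectation (C : ConfidenceRegion S I) (v : S → ℝ) : ℝ :=
  sSup ((· ⬝ᵥ v) '' C.distributions)

variable {C : ConfidenceRegion S I}

theorem Cone.smul {p ε : S → ℝ} (hp : C.Cone p ε) {c : ℝ} (hc : 0 ≤ c) :
    C.Cone (c • p) (c • ε) := by
  refine ⟨fun y => mul_nonneg hc (hp.p_nonneg y), fun y => mul_nonneg hc (hp.ε_nonneg y),
    fun y => ?_, fun y => ?_, fun i => ?_⟩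
  · have := mul_le_mul_of_nonneg_left (hp.dev_pos y) hc
    simp only [Pi.smul_apply, smul_eq_mul, ← Finset.mul_sum]
    linarith
  · have := mul_le_mul_of_nonneg_left (hp.dev_neg y) hc
    simp only [Pi.smul_apply, smul_eq_mul, ← Finset.mul_sum]
    linarith
  · have := mul_le_mul_of_nonneg_left (hp.conf i) hc
    simp only [Pi.smul_apply, smul_eq_mul, mul_left_comm _ c, ← Finset.mul_sum]
    linarith

theorem center_mem_distributions (h₀ : C.center ∈ stdSimplex ℝ S) (hb : 0 ≤ C.b) :
    C.center ∈ C.distributions :=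
  ⟨h₀.2, 0, h₀.1, fun _ => le_rfl, by simp [h₀.2], by simp [h₀.2], 
    fun i => by simpa [h₀.2] using hb i⟩

theorem mem_distributions_of_sum_mul_abs_sub_le {p : S → ℝ} (hp : p ∈ stdSimplex ℝ S)
    (hdev : ∀ i, ∑ y, C.w i y * |p y - C.center y| ≤ C.b i) : p ∈ C.distributions := by
  refine ⟨hp.2, fun y => |p y - C.center y|, hp.1, fun _ => abs_nonneg _, fun y => ?_,
    fun y => ?_, by simpa [hp.2] using hdev⟩
  · simpa [hp.2] using le_abs_self (p y - C.center y)
  · simpa [hp.2] using neg_le_abs (p y - C.center y)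

theorem distributions_subset_stdSimplex : C.distributions ⊆ stdSimplex ℝ S :=
  fun _ ⟨hsum, _, hp⟩ => ⟨hp.p_nonneg, hsum⟩

theorem bddAbove_expectations (C : ConfidenceRegion S I) (v : S → ℝ) :
    BddAbove ((· ⬝ᵥ v) '' C.distributions) :=
  ((isCompact_stdSimplex ℝ S).bddAbove_image (by fun_prop)).mono
    (Set.image_mono distributions_subset_stdSimplex)

theorem dotProduct_le_maxExpectation {p : S → ℝ} (hp : p ∈ C.distributions) (v : S → ℝ) :
    p ⬝ᵥ v ≤ C.maxExpectation v :=
  le_csSup (C.bddAbove_expectations v) ⟨p, hp, rfl⟩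

theorem maxExpectation_le (hC : C.distributions.Nonempty) {v : S → ℝ} {t : ℝ}
    (ht : ∀ p ∈ C.distributions, p ⬝ᵥ v ≤ t) : C.maxExpectation v ≤ t :=
  csSup_le (hC.image _) (Set.forall_mem_image.2 ht)

theorem monotone_maxExpectation (hC : C.distributions.Nonempty) : Monotone C.maxExpectation :=
  fun _ v huv => maxExpectation_le hC fun _ hp =>
    (dotProduct_le_dotProduct_of_nonneg_left huv (distributions_subset_stdSimplex hp).1).trans
      (dotProduct_le_maxExpectation hp v)

theorem maxExpectation_const (hC : C.distributions.Nonempty) (c : ℝ) :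
    C.maxExpectation (fun _ => c) = c := by
  have hexp (p) (hp : p ∈ C.distributions) : (p ⬝ᵥ fun _ => c) = c := by
    rw [dotProduct, ← Finset.sum_mul, hp.1, one_mul]
  rw [maxExpectation, Set.image_congr hexp, hC.image_const, csSup_singleton]

theorem Cone.dotProduct_le {p ε : S → ℝ} (hp : C.Cone p ε) (v : S → ℝ) :
    p ⬝ᵥ v ≤ (∑ y, p y) * C.maxExpectation v := by
  rcases (Finset.sum_nonneg fun y _ => hp.p_nonneg y).eq_or_lt with hmass | hmass
  · have hp0 : p = 0 := (Fintype.sum_eq_zero_iff_of_nonneg hp.p_nonneg).1 hmass.symm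
    simp [hp0]
  · have hmem : (∑ y, p y)⁻¹ • p ∈ C.distributions :=
      ⟨by simp [← Finset.mul_sum, hmass.ne'], _, hp.smul (inv_nonneg.2 hmass.le)⟩
    have hle := dotProduct_le_maxExpectation hmem v
    rwa [smul_dotProduct, smul_eq_mul, inv_mul_le_iff₀ hmass] at hle

/-- The linear functionals of `(p, ε)` whose nonnegativity defines `Cone`, in the order of its
fields. -/
noncomputable def constraint (C : ConfidenceRegion S I) :
    S ⊕ S ⊕ S ⊕ S ⊕ I → Module.Dual ℝ ((S → ℝ) × (S → ℝ)) :=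
  let P : S → Module.Dual ℝ ((S → ℝ) × (S → ℝ)) := fun y => .proj y ∘ₗ .fst ℝ _ _
  let E : S → Module.Dual ℝ ((S → ℝ) × (S → ℝ)) := fun y => .proj y ∘ₗ .snd ℝ _ _
  Sum.elim P <| Sum.elim E <|
    Sum.elim (fun y => E y - (P y - C.center y • ∑ z, P z)) <|
    Sum.elim (fun y => E y - (C.center y • ∑ z, P z - P y)) fun i =>
      C.b i • ∑ y, P y - ∑ y, C.w i y • E y

theorem forall_constraint_nonneg_iff (z : (S → ℝ) × (S → ℝ)) :
    (∀ j, 0 ≤ C.constraint j z) ↔ C.Cone z.1 z.2 := by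
  simp only [constraint, Sum.forall, Sum.elim_inl, Sum.elim_inr, LinearMap.comp_apply,
    LinearMap.fst_apply, LinearMap.snd_apply, LinearMap.proj_apply, LinearMap.sub_apply,
    LinearMap.smul_apply, LinearMap.sum_apply, smul_eq_mul, sub_nonneg]
  exact ⟨fun ⟨hp, hε, hpos, hneg, hconf⟩ => ⟨hp, hε, hpos, hneg, hconf⟩,
    fun ⟨hp, hε, hpos, hneg, hconf⟩ => ⟨hp, hε, hpos, hneg, hconf⟩⟩

/-- The functional `(p, ε) ↦ ∑ y, p y * v y` on the space of the cone. -/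
noncomputable def expectation (v : S → ℝ) : Module.Dual ℝ ((S → ℝ) × (S → ℝ)) :=
  (dotProductBilin ℝ ℝ).flip v ∘ₗ .fst ℝ _ _

theorem exists_dotProduct_eq_maxExpectation [Finite I] (hC : C.distributions.Nonempty)
    (v : S → ℝ) : ∃ p ∈ C.distributions, p ⬝ᵥ v = C.maxExpectation v := by
  have hslice : {z | (∀ j, 0 ≤ C.constraint j z) ∧ expectation 1 z = 1} =
      {z | C.Cone z.1 z.2 ∧ ∑ y, z.1 y = 1} := by
    simp_rw [forall_constraint_nonneg_iff]
    simp [expectation, dotProduct_one]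
  have himage : expectation v '' {z | C.Cone z.1 z.2 ∧ ∑ y, z.1 y = 1} =
      (· ⬝ᵥ v) '' C.distributions := by
    ext t
    constructor
    · rintro ⟨z, ⟨hz, hmass⟩, rfl⟩
      exact ⟨z.1, ⟨hmass, z.2, hz⟩, rfl⟩
    · rintro ⟨p, ⟨hmass, ε, hp⟩, rfl⟩
      exact ⟨(p, ε), ⟨hp, hmass⟩, rfl⟩
  have hne : {z : (S → ℝ) × (S → ℝ) | C.Cone z.1 z.2 ∧ ∑ y, z.1 y = 1}.Nonempty :=
    let ⟨p, hmass, ε, hp⟩ := hC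
    ⟨(p, ε), hp, hmass⟩
  obtain ⟨z, hz, hmax⟩ := exists_isMaxOn_coneSlice C.constraint (expectation 1) (expectation v)
    (hslice ▸ hne) (hslice ▸ himage ▸ C.bddAbove_expectations v)
  rw [hslice] at hz hmax
  refine ⟨z.1, ⟨hz.2, z.2, hz.1⟩, (dotProduct_le_maxExpectation ⟨hz.2, z.2, hz.1⟩ v).antisymm ?_⟩
  exact maxExpectation_le hC fun p ⟨hmass, ε, hp⟩ => hmax (a := (p, ε)) ⟨hp, hmass⟩

section Duality

variable [Fintype I]

/-- The contribution of the confidence constraints to the Lagrangian. -/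
def slack (C : ConfidenceRegion S I) (l : ConfidenceMultipliers S I) (p ε : S → ℝ) : ℝ :=
  ∑ y, l.μp y * (ε y - (p y - C.center y * ∑ z, p z))
    + ∑ y, l.μm y * (ε y - (C.center y * ∑ z, p z - p y))
    + ∑ i, l.μ i * (C.b i * ∑ y, p y - ∑ y, C.w i y * ε y)

/-- The coefficient of `p y` in `slack`. -/
def massPrice (C : ConfidenceRegion S I) (l : ConfidenceMultipliers S I) (y : S) : ℝ :=
  l.μm y - l.μp y + ∑ z, C.center z * (l.μp z - l.μm z) + ∑ i, l.μ i * C.b i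

/-- The coefficient of `ε y` in `slack`. -/
def deviationPrice (C : ConfidenceRegion S I) (l : ConfidenceMultipliers S I) (y : S) : ℝ :=
  l.μp y + l.μm y - ∑ i, l.μ i * C.w i y

theorem slack_eq (l : ConfidenceMultipliers S I) (p ε : S → ℝ) :
    C.slack l p ε = p ⬝ᵥ C.massPrice l + ε ⬝ᵥ C.deviationPrice l := by
  have hconf : ∑ i, l.μ i * ∑ y, C.w i y * ε y = ∑ y, ε y * ∑ i, l.μ i * C.w i y := by
    simp only [Finset.mul_sum]
    rw [Finset.sum_comm]
    exact Finset.sum_congr rfl fun y _ => Finset.sum_congr rfl fun i _ => by ring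
  simp only [slack, massPrice, deviationPrice, dotProduct, mul_add, mul_sub, hconf,
    Finset.sum_add_distrib, Finset.sum_sub_distrib, ← Finset.sum_mul, ← mul_assoc]
  simp only [mul_comm]
  ring

/-- Multipliers witnessing, by Lagrangian duality, that no distribution of `C` gives `v` an
expectation larger than `t`. -/
structure IsDualCertificate (C : ConfidenceRegion S I) (l : ConfidenceMultipliers S I)
    (v : S → ℝ) (t : ℝ) : Prop where
  μp_nonneg : ∀ y, 0 ≤ l.μp y
  μm_nonneg : ∀ y, 0 ≤ l.μm y
  μ_nonneg : ∀ i, 0 ≤ l.μ i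
  deviationPrice_nonpos : ∀ y, C.deviationPrice l y ≤ 0
  add_massPrice_le : ∀ y, v y + C.massPrice l y ≤ t

theorem IsDualCertificate.dotProduct_le {l : ConfidenceMultipliers S I} {v : S → ℝ} {t : ℝ}
    (hl : C.IsDualCertificate l v t) {p : S → ℝ} (hp : p ∈ C.distributions) : p ⬝ᵥ v ≤ t := by
  obtain ⟨hmass, ε, hp⟩ := hp
  have hslack : 0 ≤ C.slack l p ε := by
    refine add_nonneg (add_nonneg ?_ ?_) ?_ <;> refine Finset.sum_nonneg fun j _ => ?_
    · exact mul_nonneg (hl.μp_nonneg j) (sub_nonneg.2 (hp.dev_pos j))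
    · exact mul_nonneg (hl.μm_nonneg j) (sub_nonneg.2 (hp.dev_neg j))
    · exact mul_nonneg (hl.μ_nonneg j) (sub_nonneg.2 (hp.conf j))
  have hε : ε ⬝ᵥ C.deviationPrice l ≤ 0 :=
    Finset.sum_nonpos fun y _ =>
      mul_nonpos_of_nonneg_of_nonpos (hp.ε_nonneg y) (hl.deviationPrice_nonpos y)
  calc p ⬝ᵥ v ≤ p ⬝ᵥ v + (p ⬝ᵥ C.massPrice l + ε ⬝ᵥ C.deviationPrice l) :=
        le_add_of_nonneg_right (slack_eq l p ε ▸ hslack)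
    _ ≤ p ⬝ᵥ (v + C.massPrice l) := by rw [dotProduct_add]; linarith
    _ ≤ p ⬝ᵥ fun _ => t := dotProduct_le_dotProduct_of_nonneg_left hl.add_massPrice_le hp.p_nonneg
    _ = t := by rw [dotProduct, ← Finset.sum_mul, hmass, one_mul]

theorem exists_isDualCertificate (v : S → ℝ) {t : ℝ} (ht : C.maxExpectation v ≤ t) :
    ∃ l, C.IsDualCertificate l v t := by
  classical
  obtain ⟨l, hl, hsum⟩ := exists_nonneg_sum_smul_eq_of_forall_nonneg C.constraint
    (expectation ((fun _ => t) - v)) fun z hz => by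
      have hz' := (forall_constraint_nonneg_iff z).1 hz
      have hmass : 0 ≤ ∑ y, z.1 y := Finset.sum_nonneg fun y _ => hz'.p_nonneg y
      have hle := (hz'.dotProduct_le v).trans (mul_le_mul_of_nonneg_left ht hmass)
      change 0 ≤ z.1 ⬝ᵥ ((fun _ => t) - v)
      rw [dotProduct_sub, sub_nonneg]
      exact hle.trans_eq (Finset.sum_mul ..)
  let m : ConfidenceMultipliers S I :=
    { μp := fun y => l (.inr (.inr (.inl y)))
      μm := fun y => l (.inr (.inr (.inr (.inl y))))
      μ := fun i => l (.inr (.inr (.inr (.inr i)))) }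
  have hidentity (p ε : S → ℝ) :
      ∑ y, l (.inl y) * p y + ∑ y, l (.inr (.inl y)) * ε y
        + (p ⬝ᵥ C.massPrice m + ε ⬝ᵥ C.deviationPrice m) = p ⬝ᵥ ((fun _ => t) - v) := by
    rw [← slack_eq]
    simpa [constraint, slack, expectation, m, add_assoc] using LinearMap.congr_fun hsum (p, ε)
  refine ⟨m, fun _ => hl _, fun _ => hl _, fun _ => hl _, fun y => ?_, fun y => ?_⟩
  · have hy := hidentity 0 (Pi.single y 1)
    simp only [Pi.single_apply, Pi.zero_apply, mul_zero, Finset.sum_const_zero, mul_ite, mul_one,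
      Finset.sum_ite_eq', Finset.mem_univ, if_true, zero_dotProduct, single_one_dotProduct] at hy
    have := hl (.inr (.inl y))
    rw [Pi.zero_apply] at this
    linarith
  · have hy := hidentity (Pi.single y 1) 0
    simp only [Pi.single_apply, Pi.zero_apply, mul_zero, Finset.sum_const_zero, mul_ite, mul_one,
      Finset.sum_ite_eq', Finset.mem_univ, if_true, zero_dotProduct, single_one_dotProduct,
      Pi.sub_apply] at hy
    have := hl (.inl y)
    rw [Pi.zero_apply] at this
    linarith

theorem maxExpectation_le_iff (hC : C.distributions.Nonempty) {v : S → ℝ} {t : ℝ} :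
    C.maxExpectation v ≤ t ↔ ∃ l, C.IsDualCertificate l v t :=
  ⟨exists_isDualCertificate v, fun ⟨_, hl⟩ => maxExpectation_le hC fun _ => hl.dotProduct_le⟩

end Duality

end ConfidenceRegion

section DynamicProgramming

theorem le_of_subsolution_of_supersolution {R S A : Type*} [Preorder R] {H : ℕ}
    {T : Fin H → (S → R) → S → A → R} (hT : ∀ h, Monotone (T h)) {β β' : Fin (H + 1) → S → R}
    (hsub : ∀ h x, ∃ a, β h.castSucc x ≤ T h (β h.succ) x a)
    (hsuper : ∀ h x a, T h (β' h.succ) x a ≤ β' h.castSucc x)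
    (hlast : β (Fin.last H) ≤ β' (Fin.last H)) : β ≤ β' := by
  intro h
  induction h using Fin.reverseInduction with
  | last => exact hlast
  | cast h ih =>
    intro x
    obtain ⟨a, ha⟩ := hsub h x
    exact ha.trans ((hT h ih x a).trans (hsuper h x a))

variable {R S : Type*} [CommSemiring R] {n : ℕ}

/-- The probability that the Markov chain with transition kernels `K`, started at `x`, follows
the states `ω`. -/
def trajectoryWeight (K : Fin n → S → S → R) (x : S) (ω : Fin n → S) : R :=
  ∏ k, K k (Fin.cons (α := fun _ => S) x ω k.castSucc) (ω k)

theorem trajectoryWeight_cons (K : Fin (n + 1) → S → S → R) (x y : S) (ω : Fin n → S) :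
    trajectoryWeight K x (Fin.cons y ω) =
      K 0 x y * trajectoryWeight (fun k => K k.succ) y ω := by
  simp [trajectoryWeight, Fin.prod_univ_succ]

variable [Fintype S]

theorem sum_pi_fin_succ {N : Type*} [AddCommMonoid N] (f : (Fin (n + 1) → S) → N) :
    ∑ ω, f ω = ∑ y, ∑ ω : Fin n → S, f (Fin.cons y ω) := by
  rw [← (Fin.consEquiv fun _ => S).sum_comp, Fintype.sum_prod_type]
  rfl

theorem sum_trajectoryWeight (K : Fin n → S → S → R) (hK : ∀ k x, ∑ y, K k x y = 1) (x : S) :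
    ∑ ω, trajectoryWeight K x ω = 1 := by
  induction n generalizing x with
  | zero => simp [trajectoryWeight]
  | succ n ih =>
    simp only [sum_pi_fin_succ, trajectoryWeight_cons, ← Finset.mul_sum,
      ih (fun k => K k.succ) (fun k => hK k.succ), mul_one, hK]

/-- The expected total reward of the Markov chain with transition kernels `K` and rewards `ρ`,
started at `x`. -/
def chainValue (K : Fin n → S → S → R) (ρ : Fin n → S → R) (x : S) : R :=
  ∑ ω, trajectoryWeight K x ω * ∑ k, ρ k (Fin.cons (α := fun _ => S) x ω k.castSucc)

theorem chainValue_cast {m : ℕ} (e : n = m) (K : Fin m → S → S → R) (ρ : Fin m → S → R) :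
    chainValue (fun k => K (k.cast e)) (fun k => ρ (k.cast e)) = chainValue K ρ := by
  subst e
  rfl

theorem chainValue_succ (K : Fin (n + 1) → S → S → R) (hK : ∀ k x, ∑ y, K k x y = 1)
    (ρ : Fin (n + 1) → S → R) (x : S) :
    chainValue K ρ x =
      ρ 0 x + ∑ y, K 0 x y * chainValue (fun k => K k.succ) (fun k => ρ k.succ) y := by
  have htotal (y : S) := sum_trajectoryWeight (fun k => K k.succ) (fun k => hK k.succ) y
  calc chainValue K ρ x
      = ∑ y, K 0 x y * ∑ ω, trajectoryWeight (fun k => K k.succ) y ω *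
          (ρ 0 x + ∑ k : Fin n, ρ k.succ (Fin.cons (α := fun _ => S) y ω k.castSucc)) := by
        simp only [chainValue, sum_pi_fin_succ, trajectoryWeight_cons, Fin.sum_univ_succ,
          Finset.mul_sum, mul_assoc, ← Fin.succ_castSucc, Fin.cons_succ, Fin.castSucc_zero,
          Fin.cons_zero]
    _ = ∑ y, K 0 x y * (ρ 0 x + chainValue (fun k => K k.succ) (fun k => ρ k.succ) y) := by
        simp only [mul_add, Finset.sum_add_distrib, ← Finset.sum_mul, htotal, one_mul, chainValue]
    _ = _ := by
        simp only [mul_add, Finset.sum_add_distrib, ← Finset.sum_mul, hK, one_mul]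

variable {A : Type*} {H : ℕ}

theorem policyValue_eq_chainValue (P : Fin H → S → A → S → ℝ) (r : Fin H → S → A → ℝ)
    (π : Fin H → S → A) (h : Fin (H + 1)) :
    policyValue P r π h =
      chainValue (fun k x => P (stageAfter h k) x (π (stageAfter h k) x))
        (fun k x => r (stageAfter h k) x (π (stageAfter h k) x)) :=
  rfl

theorem policyValue_last (P : Fin H → S → A → S → ℝ) (r : Fin H → S → A → ℝ)
    (π : Fin H → S → A) : policyValue P r π (Fin.last H) = 0 := by
  have hlength : 0 = H - (Fin.last H : ℕ) := by simp
  ext x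
  rw [policyValue_eq_chainValue, ← chainValue_cast hlength]
  simp [chainValue]

theorem policyValue_castSucc {P : Fin H → S → A → S → ℝ} (hP : IsTransition P)
    (r : Fin H → S → A → ℝ) (π : Fin H → S → A) (h : Fin H) (x : S) :
    policyValue P r π h.castSucc x =
      r h x (π h x) + P h x (π h x) ⬝ᵥ policyValue P r π h.succ := by
  have hlength : H - (h.succ : ℕ) + 1 = H - (h.castSucc : ℕ) := by
    rw [Fin.val_succ, Fin.val_castSucc]
    omega
  have hfirst : stageAfter h.castSucc ((0 : Fin (H - (h.succ : ℕ) + 1)).cast hlength) = h :=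
    Fin.ext (by simp [stageAfter])
  have hlater (k : Fin (H - (h.succ : ℕ))) :
      stageAfter h.castSucc (k.succ.cast hlength) = stageAfter h.succ k :=
    Fin.ext (by simp [stageAfter]; omega)
  rw [policyValue_eq_chainValue, ← chainValue_cast hlength,
    chainValue_succ _ fun _ _ => hP.sum_one _ _ _]
  simp only [hfirst, hlater, policyValue_eq_chainValue, dotProduct]

end DynamicProgramming

namespace Multipliers

variable {S A I : Type*} {H : ℕ}

/-- The multipliers of the confidence constraints in stage `h` at the state `x` and action `a`. -/
def confidence (m : Multipliers S A I H) (h : Fin H) (x : S) (a : A) :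
    ConfidenceMultipliers S I where
  μp := m.μp h x a
  μm := m.μm h x a
  μ i := m.μ h i x a

end Multipliers

namespace OptimisticModel

variable {S A I : Type*} [Fintype S] {H : ℕ}

/-- The confidence constraints in stage `h` at the state `x` and action `a`. -/
def region (M : OptimisticModel S A I H) (h : Fin H) (x : S) (a : A) :
    ConfidenceRegion S I where
  center := M.Phat h x a
  w := M.w h
  b i := M.b h i x a

/-- The right-hand side of the Bellman inequality in which the next state is distributed as
favourably for the value function `v` as the confidence region permits. -/
noncomputable def optimisticBackup (M : OptimisticModel S A I H) (h : Fin H) (v : S → ℝ) (x : S)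
    (a : A) : ℝ :=
  M.r h x a + (M.region h x a).maxExpectation v

/-- The exploration bonus: the increase of the expectation of `v` that optimism within the
confidence region affords over the reference distribution. -/
noncomputable def bonus (M : OptimisticModel S A I H) (h : Fin H) (v : S → ℝ) (x : S) (a : A) :
    ℝ :=
  (M.region h x a).maxExpectation v - M.Phat h x a ⬝ᵥ v

variable (M : OptimisticModel S A I H)

theorem Phat_mem_distributions (h : Fin H) (x : S) (a : A) :
    M.Phat h x a ∈ (M.region h x a).distributions :=
  ConfidenceRegion.center_mem_distributions
    ⟨M.Phat_transition.nonneg h x a, M.Phat_transition.sum_one h x a⟩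
    fun i => M.b_nonneg h i x a

theorem distributions_nonempty (h : Fin H) (x : S) (a : A) :
    (M.region h x a).distributions.Nonempty :=
  ⟨_, M.Phat_mem_distributions h x a⟩

theorem InConfidenceSet.mem_distributions {M : OptimisticModel S A I H}
    {P : Fin H → S → A → S → ℝ} (hPM : M.InConfidenceSet P) (hP : IsTransition P) (h : Fin H)
    (x : S) (a : A) : P h x a ∈ (M.region h x a).distributions :=
  ConfidenceRegion.mem_distributions_of_sum_mul_abs_sub_le
    ⟨hP.nonneg h x a, hP.sum_one h x a⟩ fun i => hPM h i x a

theorem bonus_nonneg (h : Fin H) (v : S → ℝ) (x : S) (a : A) : 0 ≤ M.bonus h v x a :=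
  sub_nonneg.2
    (ConfidenceRegion.dotProduct_le_maxExpectation (M.Phat_mem_distributions h x a) v)

theorem backup_bonus (h : Fin H) (v : S → ℝ) (x : S) (a : A) :
    M.backup h x a (M.bonus h v x a) v = M.optimisticBackup h v x a := by
  simp only [backup, bonus, optimisticBackup, dotProduct]
  ring

theorem monotone_optimisticBackup (h : Fin H) : Monotone (M.optimisticBackup h) :=
  fun _ _ huv x a => add_le_add_right
    (ConfidenceRegion.monotone_maxExpectation (M.distributions_nonempty h x a) huv) _

theorem monotone_backup (c : S → A → ℝ) (h : Fin H) :
    Monotone fun v x a => M.backup h x a (c x a) v :=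
  fun _ _ huv x a => add_le_add_right (Finset.sum_le_sum fun y _ =>
    mul_le_mul_of_nonneg_left (huv y) (M.Phat_transition.nonneg h x a y)) _

theorem monotone_initialValue : Monotone M.initialValue :=
  fun _ _ hβ => Finset.sum_le_sum fun x _ => mul_le_mul_of_nonneg_left (hβ 0 x) (M.α_nonneg x)

section OptimisticValue

/-- The value function obtained from the terminal value `0` by backward induction, maximizing the
optimistic backup in every stage. -/
noncomputable def optimisticValue (M : OptimisticModel S A I H) : Fin (H + 1) → S → ℝ :=
  Fin.reverseInduction (motive := fun _ => S → ℝ) 0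
    fun h v x => ⨆ a, M.optimisticBackup h v x a

/-- The exploration bonus at the optimistic value function. -/
noncomputable def optimisticBonus (M : OptimisticModel S A I H) (h : Fin H) (x : S) (a : A) :
    ℝ :=
  M.bonus h (M.optimisticValue h.succ) x a

theorem optimisticValue_last : M.optimisticValue (Fin.last H) = 0 := by
  rw [optimisticValue, Fin.reverseInduction_last]

theorem optimisticValue_castSucc (h : Fin H) (x : S) :
    M.optimisticValue h.castSucc x = ⨆ a, M.optimisticBackup h (M.optimisticValue h.succ) x a := by
  rw [optimisticValue, Fin.reverseInduction_castSucc]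

variable [Finite A]

theorem optimisticBackup_le_optimisticValue (h : Fin H) (x : S) (a : A) :
    M.optimisticBackup h (M.optimisticValue h.succ) x a ≤ M.optimisticValue h.castSucc x := by
  rw [optimisticValue_castSucc]
  exact le_ciSup (Set.finite_range (M.optimisticBackup h (M.optimisticValue h.succ) x)).bddAbove a

theorem policyValue_le_optimisticValue {P : Fin H → S → A → S → ℝ} (hP : IsTransition P)
    (hPM : M.InConfidenceSet P) (π : Fin H → S → A) :
    policyValue P M.r π ≤ M.optimisticValue := by
  refine le_of_subsolution_of_supersolution M.monotone_optimisticBackup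
    (fun h x => ⟨π h x, ?_⟩) M.optimisticBackup_le_optimisticValue
    (by rw [policyValue_last, optimisticValue_last])
  rw [policyValue_castSucc hP, optimisticBackup]
  exact add_le_add_right
    (ConfidenceRegion.dotProduct_le_maxExpectation (hPM.mem_distributions hP h x _) _) _

theorem bellmanFeasible_optimisticValue :
    M.BellmanFeasible M.optimisticBonus M.optimisticValue := by
  refine ⟨fun x => congr_fun M.optimisticValue_last x, fun h x a => ?_⟩
  rw [optimisticBonus, backup_bonus]
  exact M.optimisticBackup_le_optimisticValue h x a

variable [Nonempty A]

theorem exists_optimisticBackup_eq_optimisticValue (h : Fin H) (x : S) :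
    ∃ a, M.optimisticBackup h (M.optimisticValue h.succ) x a = M.optimisticValue h.castSucc x := by
  rw [optimisticValue_castSucc]
  exact exists_eq_ciSup_of_finite

theorem optimisticValue_le_of_optimisticBackup_le {β : Fin (H + 1) → S → ℝ}
    (hβ : ∀ h x a, M.optimisticBackup h (β h.succ) x a ≤ β h.castSucc x)
    (hlast : 0 ≤ β (Fin.last H)) : M.optimisticValue ≤ β :=
  le_of_subsolution_of_supersolution M.monotone_optimisticBackup
    (fun h x => (M.exists_optimisticBackup_eq_optimisticValue h x).imp fun _ => Eq.ge) hβ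
    (M.optimisticValue_last.trans_le hlast)

theorem optimisticValue_le_horizon (h : Fin (H + 1)) (x : S) :
    M.optimisticValue h x ≤ (H : ℝ) - (h : ℕ) := by
  refine M.optimisticValue_le_of_optimisticBackup_le
    (β := fun h _ => (H : ℝ) - (h : ℕ)) (fun h x a => ?_) (fun x => by simp) h x
  rw [optimisticBackup, ConfidenceRegion.maxExpectation_const (M.distributions_nonempty h x a)]
  simp only [Fin.val_succ, Fin.val_castSucc, Nat.cast_add, Nat.cast_one]
  linarith [M.r_le_one h x a]

theorem optimalValue_le_optimisticValue {P : Fin H → S → A → S → ℝ} (hP : IsTransition P)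
    (hPM : M.InConfidenceSet P) (h : Fin (H + 1)) (x : S) :
    optimalValue P M.r h x ≤ M.optimisticValue h x :=
  ciSup_le fun π => M.policyValue_le_optimisticValue hP hPM π h x

theorem optimisticValue_le_of_bellmanFeasible {β : Fin (H + 1) → S → ℝ}
    (hβ : M.BellmanFeasible M.optimisticBonus β) : M.optimisticValue ≤ β := by
  refine le_of_subsolution_of_supersolution
    (fun h => M.monotone_backup (M.optimisticBonus h) h) (fun h x => ?_) hβ.2
    (M.optimisticValue_last.trans_le fun x => (hβ.1 x).ge)
  obtain ⟨a, ha⟩ := M.exists_optimisticBackup_eq_optimisticValue h x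
  exact ⟨a, by rw [optimisticBonus, backup_bonus, ha]⟩

theorem isLeast_bellmanValue :
    IsLeast {v : ℝ | ∃ β, M.BellmanFeasible M.optimisticBonus β ∧ v = M.initialValue β}
      (M.initialValue M.optimisticValue) := by
  refine ⟨⟨_, M.bellmanFeasible_optimisticValue, rfl⟩, ?_⟩
  rintro _ ⟨β, hβ, rfl⟩
  exact M.monotone_initialValue (M.optimisticValue_le_of_bellmanFeasible hβ)

end OptimisticValue

section Flow

variable {M} {β : Fin (H + 1) → S → ℝ}

/-- The temporal difference of the value function `β` along a transition from `x` to `y`; for a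
feasible flow the sum of these accounts for the difference between its reward and the initial
value of `β`. -/
def temporalDifference (M : OptimisticModel S A I H) (β : Fin (H + 1) → S → ℝ) (h : Fin H) (x : S)
    (a : A) (y : S) : ℝ :=
  M.r h x a + β h.succ y - β h.castSucc x

theorem dotProduct_temporalDifference (p : S → ℝ) (h : Fin H) (x : S) (a : A) :
    p ⬝ᵥ M.temporalDifference β h x a =
      (∑ y, p y) * (M.r h x a - β h.castSucc x) + p ⬝ᵥ β h.succ := by
  simp only [dotProduct, temporalDifference, Finset.sum_mul, ← Finset.sum_add_distrib]
  exact Finset.sum_congr rfl fun y _ => by ring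

variable [Fintype A]

theorem inflow_zero (M : OptimisticModel S A I (H + 1)) (q : Fin (H + 1) → S → A → S → ℝ) (x : S) :
    M.inflow q 0 x = M.α x := by
  simp [inflow]

theorem inflow_succ (M : OptimisticModel S A I (H + 1)) (q : Fin (H + 1) → S → A → S → ℝ)
    (h : Fin H) (x : S) : M.inflow q h.succ x = ∑ z, ∑ a, q h.castSucc z a x := by
  simp only [inflow, Fin.val_succ, Nat.succ_ne_zero, if_false, Nat.add_sub_cancel]
  rfl

theorem sum_mul_inflow (hβ : β (Fin.last H) = 0) (q : Fin H → S → A → S → ℝ) :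
    ∑ h, ∑ x, β h.castSucc x * M.inflow q h x =
      M.initialValue β + ∑ h, ∑ x, ∑ a, q h x a ⬝ᵥ β h.succ := by
  cases H with
  | zero => simp [initialValue, show β 0 = 0 from hβ]
  | succ n =>
    have hstage (u : S → ℝ) (p : S → A → S → ℝ) :
        ∑ x, u x * ∑ z, ∑ a, p z a x = ∑ z, ∑ a, p z a ⬝ᵥ u := by
      simp only [Finset.mul_sum]
      rw [Finset.sum_comm]
      refine Finset.sum_congr rfl fun z _ => ?_
      rw [Finset.sum_comm]
      exact Finset.sum_congr rfl fun a _ => dotProduct_comm u (p z a)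
    rw [Fin.sum_univ_succ, Fin.sum_univ_castSucc (fun h => ∑ x, ∑ a, q h x a ⬝ᵥ β h.succ)]
    simp [inflow_zero, inflow_succ, hstage, hβ, initialValue, mul_comm (β 0 _)]

theorem sum_mul_outflow (β : Fin (H + 1) → S → ℝ) (q : Fin H → S → A → S → ℝ) :
    ∑ h, ∑ x, β h.castSucc x * outflow q h x =
      ∑ h, ∑ x, ∑ a, (∑ y, q h x a y) * β h.castSucc x := by
  simp only [outflow, ← Finset.sum_mul, mul_comm (β _ _)]

theorem primalObj_add_sum_mul_flow (hβ : β (Fin.last H) = 0) (q : Fin H → S → A → S → ℝ) :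
    M.primalObj q + ∑ h, ∑ x, β h.castSucc x * (M.inflow q h x - outflow q h x) =
      M.initialValue β + ∑ h, ∑ x, ∑ a, q h x a ⬝ᵥ M.temporalDifference β h x a := by
  simp only [mul_sub, Finset.sum_sub_distrib, sum_mul_inflow hβ, sum_mul_outflow, primalObj,
    dotProduct_temporalDifference, Finset.sum_add_distrib, ← Finset.sum_mul]
  ring

end Flow

section Dual

variable [Fintype A] [Fintype I] {M} {m : Multipliers S A I H} {β : Fin (H + 1) → S → ℝ}

theorem lagrangian_eq_add_sum_slack (q ε : Fin H → S → A → S → ℝ) :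
    M.lagrangian q ε m = M.primalObj q + ∑ h, ∑ x, m.β h x * (M.inflow q h x - outflow q h x) +
      ∑ h, ∑ x, ∑ a, (M.region h x a).slack (m.confidence h x a) (q h x a) (ε h x a) := by
  have hconf (h : Fin H) : ∑ i, ∑ x, ∑ a,
        m.μ h i x a * (M.b h i x a * ∑ y, q h x a y - ∑ y, M.w h i y * ε h x a y) =
      ∑ x, ∑ a, ∑ i,
        m.μ h i x a * (M.b h i x a * ∑ y, q h x a y - ∑ y, M.w h i y * ε h x a y) := by
    rw [Finset.sum_comm]
    exact Finset.sum_congr rfl fun x _ => Finset.sum_comm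
  simp only [lagrangian, hconf, ConfidenceRegion.slack, region, Multipliers.confidence,
    Finset.sum_add_distrib]
  ring

theorem lagrangian_eq (hm : ∀ h, m.β h = β h.castSucc) (hβ : β (Fin.last H) = 0)
    (q ε : Fin H → S → A → S → ℝ) :
    M.lagrangian q ε m = M.initialValue β + ∑ h, ∑ x, ∑ a,
      (q h x a ⬝ᵥ (M.temporalDifference β h x a +
          (M.region h x a).massPrice (m.confidence h x a)) +
        ε h x a ⬝ᵥ (M.region h x a).deviationPrice (m.confidence h x a)) := by
  simp only [lagrangian_eq_add_sum_slack, hm, primalObj_add_sum_mul_flow hβ,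
    ConfidenceRegion.slack_eq, dotProduct_add, Finset.sum_add_distrib]
  ring

theorem isLUB_lagrangian_iff (hm : ∀ h, m.β h = β h.castSucc) (hβ : β (Fin.last H) = 0)
    {v : ℝ} :
    IsLUB {l : ℝ | ∃ q ε : Fin H → S → A → S → ℝ, (∀ h x a y, 0 ≤ q h x a y) ∧
      (∀ h x a y, 0 ≤ ε h x a y) ∧ l = M.lagrangian q ε m} v ↔
    v = M.initialValue β ∧
      (∀ h x a y, M.temporalDifference β h x a y +
        (M.region h x a).massPrice (m.confidence h x a) y ≤ 0) ∧
      ∀ h x a y, (M.region h x a).deviationPrice (m.confidence h x a) y ≤ 0 := by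
  let f : (Fin H × S × A × S) ⊕ (Fin H × S × A × S) → ℝ := Sum.elim
    (fun ⟨h, x, a, y⟩ => M.temporalDifference β h x a y +
      (M.region h x a).massPrice (m.confidence h x a) y)
    (fun ⟨h, x, a, y⟩ => (M.region h x a).deviationPrice (m.confidence h x a) y)
  have himage : {l : ℝ | ∃ q ε : Fin H → S → A → S → ℝ, (∀ h x a y, 0 ≤ q h x a y) ∧
      (∀ h x a y, 0 ≤ ε h x a y) ∧ l = M.lagrangian q ε m} =
      (fun z => M.initialValue β + z ⬝ᵥ f) '' Set.Ici 0 := by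
    ext l
    constructor
    · rintro ⟨q, ε, hq, hε, rfl⟩
      refine ⟨Sum.elim (fun ⟨h, x, a, y⟩ => q h x a y) (fun ⟨h, x, a, y⟩ => ε h x a y), ?_, ?_⟩
      · rintro (⟨h, x, a, y⟩ | ⟨h, x, a, y⟩)
        exacts [hq h x a y, hε h x a y]
      · simp [f, lagrangian_eq hm hβ, dotProduct, Fintype.sum_prod_type, Finset.sum_add_distrib]
    · rintro ⟨z, hz, rfl⟩
      refine ⟨fun h x a y => z (.inl (h, x, a, y)), fun h x a y => z (.inr (h, x, a, y)),
        fun _ _ _ _ => hz _, fun _ _ _ _ => hz _, ?_⟩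
      simp [f, lagrangian_eq hm hβ, dotProduct, Fintype.sum_prod_type, Finset.sum_add_distrib]
  rw [himage, isLUB_image_const_add_dotProduct_iff]
  simp [f, Pi.le_def]

theorem isDualValue_iff (hm : ∀ h, m.β h = β h.castSucc) (hβ : β (Fin.last H) = 0) {v : ℝ} :
    M.IsDualValue m v ↔ v = M.initialValue β ∧ ∀ h x a,
      (M.region h x a).IsDualCertificate (m.confidence h x a) (β h.succ)
        (β h.castSucc x - M.r h x a) := by
  have hprice (h x a y) : M.temporalDifference β h x a y +
        (M.region h x a).massPrice (m.confidence h x a) y ≤ 0 ↔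
      β h.succ y + (M.region h x a).massPrice (m.confidence h x a) y ≤
        β h.castSucc x - M.r h x a := by
    rw [temporalDifference, ← sub_nonpos (b := β h.castSucc x - M.r h x a)]
    ring_nf
  rw [IsDualValue, isLUB_lagrangian_iff hm hβ]
  simp only [hprice]
  constructor
  · rintro ⟨hnonneg, hv, hmass, hdev⟩
    exact ⟨hv, fun h x a => ⟨hnonneg.μp h x a, hnonneg.μm h x a, fun i => hnonneg.μ h i x a,
      hdev h x a, hmass h x a⟩⟩
  · rintro ⟨hv, hcert⟩
    exact ⟨⟨fun h x a => (hcert h x a).μp_nonneg, fun h x a => (hcert h x a).μm_nonneg,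
      fun h i x a => (hcert h x a).μ_nonneg i⟩, hv, fun h x a => (hcert h x a).add_massPrice_le,
      fun h x a => (hcert h x a).deviationPrice_nonpos⟩

theorem exists_isDualValue_iff (hβ : β (Fin.last H) = 0) {v : ℝ} :
    (∃ m : Multipliers S A I H, (∀ h, m.β h = β h.castSucc) ∧ M.IsDualValue m v) ↔
      v = M.initialValue β ∧
        ∀ h x a, M.optimisticBackup h (β h.succ) x a ≤ β h.castSucc x := by
  simp only [optimisticBackup, ← le_sub_iff_add_le',
    ConfidenceRegion.maxExpectation_le_iff (M.distributions_nonempty _ _ _)]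
  constructor
  · rintro ⟨m, hm, hv⟩
    have hv' := (isDualValue_iff hm hβ).1 hv
    exact ⟨hv'.1, fun h x a => ⟨_, hv'.2 h x a⟩⟩
  · rintro ⟨hv, hcert⟩
    choose l hl using hcert
    exact ⟨⟨fun h => β h.castSucc, fun h x a => (l h x a).μp, fun h x a => (l h x a).μm,
      fun h i x a => (l h x a).μ i⟩, fun _ => rfl, (isDualValue_iff (fun _ => rfl) hβ).2 ⟨hv, hl⟩⟩

theorem exists_isDualValue_optimisticValue :
    ∃ m : Multipliers S A I H, (∀ h, m.β h = M.optimisticValue h.castSucc) ∧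
      M.IsDualValue m (M.initialValue M.optimisticValue) :=
  (exists_isDualValue_iff M.optimisticValue_last).2
    ⟨rfl, M.optimisticBackup_le_optimisticValue⟩

theorem isLeast_dualValue [Nonempty A] :
    IsLeast {v : ℝ | ∃ m : Multipliers S A I H, M.IsDualValue m v}
      (M.initialValue M.optimisticValue) := by
  refine ⟨exists_isDualValue_optimisticValue.imp fun _ => And.right, ?_⟩
  rintro v ⟨m, hv⟩
  let β : Fin (H + 1) → S → ℝ := Fin.snoc (α := fun _ => S → ℝ) m.β 0
  have hlast : β (Fin.last H) = 0 := Fin.snoc_last (α := fun _ => S → ℝ) 0 m.β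
  obtain ⟨rfl, hβ⟩ := (exists_isDualValue_iff hlast).1
    ⟨m, fun h => (Fin.snoc_castSucc (α := fun _ => S → ℝ) 0 m.β h).symm, hv⟩
  exact M.monotone_initialValue
    (M.optimisticValue_le_of_optimisticBackup_le hβ hlast.ge)

end Dual

section Primal

variable [Fintype A] {M} {q ε : Fin H → S → A → S → ℝ} {β : Fin (H + 1) → S → ℝ}

theorem primalObj_eq_of_flow (hflow : ∀ h x, outflow q h x = M.inflow q h x)
    (hβ : β (Fin.last H) = 0) : M.primalObj q =
      M.initialValue β + ∑ h, ∑ x, ∑ a, q h x a ⬝ᵥ M.temporalDifference β h x a := by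
  rw [← primalObj_add_sum_mul_flow hβ]
  simp [hflow]

theorem PrimalFeasible.cone (hq : M.PrimalFeasible q ε) (h : Fin H) (x : S) (a : A) :
    (M.region h x a).Cone (q h x a) (ε h x a) :=
  ⟨hq.q_nonneg h x a, hq.ε_nonneg h x a, hq.dev_pos h x a, hq.dev_neg h x a,
    fun i => hq.conf h i x a⟩

theorem PrimalFeasible.sum_mul_sub_optimisticBackup_le (hq : M.PrimalFeasible q ε)
    (hβ : β (Fin.last H) = 0) :
    ∑ h, ∑ x, ∑ a, (∑ y, q h x a y) * (β h.castSucc x - M.optimisticBackup h (β h.succ) x a) ≤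
      M.initialValue β - M.primalObj q := by
  rw [primalObj_eq_of_flow hq.flow hβ, sub_add_cancel_left]
  simp only [← Finset.sum_neg_distrib]
  refine Finset.sum_le_sum fun h _ => Finset.sum_le_sum fun x _ => Finset.sum_le_sum fun a _ => ?_
  rw [dotProduct_temporalDifference, optimisticBackup]
  linarith [(hq.cone h x a).dotProduct_le (β h.succ)]

theorem PrimalFeasible.primalObj_le_initialValue (hq : M.PrimalFeasible q ε)
    (hlast : β (Fin.last H) = 0)
    (hβ : ∀ h x a, M.optimisticBackup h (β h.succ) x a ≤ β h.castSucc x) :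
    M.primalObj q ≤ M.initialValue β := by
  refine sub_nonneg.1 (le_trans ?_ (hq.sum_mul_sub_optimisticBackup_le hlast))
  exact Finset.sum_nonneg fun h _ => Finset.sum_nonneg fun x _ => Finset.sum_nonneg fun a _ =>
    mul_nonneg (Finset.sum_nonneg fun y _ => hq.q_nonneg h x a y) (sub_nonneg.2 (hβ h x a))

theorem PrimalFeasible.eq_optimisticBackup (hq : M.PrimalFeasible q ε)
    (hlast : β (Fin.last H) = 0)
    (hβ : ∀ h x a, M.optimisticBackup h (β h.succ) x a ≤ β h.castSucc x)
    (hopt : M.initialValue β ≤ M.primalObj q) {h : Fin H} {x : S} {a : A}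
    (hmass : 0 < ∑ y, q h x a y) :
    β h.castSucc x = M.optimisticBackup h (β h.succ) x a := by
  let loss (i : Fin H × S × A) : ℝ := (∑ y, q i.1 i.2.1 i.2.2 y) *
    (β i.1.castSucc i.2.1 - M.optimisticBackup i.1 (β i.1.succ) i.2.1 i.2.2)
  have hloss_nonneg (i) : 0 ≤ loss i :=
    mul_nonneg (Finset.sum_nonneg fun y _ => hq.q_nonneg _ _ _ y) (sub_nonneg.2 (hβ _ _ _))
  have hsum : ∑ i, loss i ≤ 0 := by
    simp only [loss, Fintype.sum_prod_type]
    exact (hq.sum_mul_sub_optimisticBackup_le hlast).trans (sub_nonpos.2 hopt)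
  have hloss : loss (h, x, a) ≤ 0 :=
    (Finset.single_le_sum (fun i _ => hloss_nonneg i) (Finset.mem_univ _)).trans hsum
  exact (sub_nonpos.1 (nonpos_of_mul_nonpos_right hloss hmass)).antisymm (hβ h x a)

/-- The probabilities of the states in the stages `0, …, H` under the initial distribution `α`, the
stochastic policy `κ` and the transition function `P`. -/
def stateDistribution (α : S → ℝ) (κ : Fin H → S → A → ℝ) (P : Fin H → S → A → S → ℝ) :
    Fin (H + 1) → S → ℝ :=
  Fin.induction (motive := fun _ => S → ℝ) α fun h d y => ∑ x, ∑ a, d x * κ h x a * P h x a y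

theorem stateDistribution_zero (α : S → ℝ) (κ : Fin H → S → A → ℝ) (P : Fin H → S → A → S → ℝ) :
    stateDistribution α κ P 0 = α :=
  rfl

theorem stateDistribution_succ (α : S → ℝ) (κ : Fin H → S → A → ℝ) (P : Fin H → S → A → S → ℝ)
    (h : Fin H) (y : S) : stateDistribution α κ P h.succ y =
      ∑ x, ∑ a, stateDistribution α κ P h.castSucc x * κ h x a * P h x a y := by
  simp only [stateDistribution, Fin.induction_succ]

theorem stateDistribution_nonneg {α : S → ℝ} {κ : Fin H → S → A → ℝ} {P : Fin H → S → A → S → ℝ}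
    (hα : 0 ≤ α) (hκ : 0 ≤ κ) (hP : ∀ h x a y, 0 ≤ P h x a y) (h : Fin (H + 1)) :
    0 ≤ stateDistribution α κ P h := by
  induction h using Fin.induction with
  | zero => exact hα
  | succ h ih =>
    intro y
    rw [stateDistribution_succ]
    exact Finset.sum_nonneg fun x _ => Finset.sum_nonneg fun a _ =>
      mul_nonneg (mul_nonneg (ih x) (hκ h x a)) (hP h x a y)

/-- The occupancy measure of the policy `κ` under the transition function `P`. -/
def occupancy (α : S → ℝ) (κ : Fin H → S → A → ℝ) (P : Fin H → S → A → S → ℝ) (h : Fin H) (x : S)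
    (a : A) : S → ℝ :=
  (stateDistribution α κ P h.castSucc x * κ h x a) • P h x a

theorem outflow_occupancy {κ : Fin H → S → A → ℝ} {P : Fin H → S → A → S → ℝ}
    (hκ : ∀ h x, ∑ a, κ h x a = 1) (hP : ∀ h x a, ∑ y, P h x a y = 1) (h : Fin H) (x : S) :
    outflow (occupancy M.α κ P) h x = M.inflow (occupancy M.α κ P) h x := by
  have hout : outflow (occupancy M.α κ P) h x = stateDistribution M.α κ P h.castSucc x := by
    simp [outflow, occupancy, ← Finset.mul_sum, hP, hκ]
  rw [hout]
  cases H with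
  | zero => exact h.elim0
  | succ n =>
    cases h using Fin.cases with
    | zero => rw [inflow_zero, Fin.castSucc_zero, stateDistribution_zero]
    | succ k =>
      rw [inflow_succ, ← Fin.succ_castSucc, stateDistribution_succ]
      rfl

theorem primalFeasible_occupancy {κ : Fin H → S → A → ℝ} {P E : Fin H → S → A → S → ℝ}
    (hκ : ∀ h x, κ h x ∈ stdSimplex ℝ A) (hP : ∀ h x a, ∑ y, P h x a y = 1)
    (hPE : ∀ h x a, (M.region h x a).Cone (P h x a) (E h x a)) :
    M.PrimalFeasible (occupancy M.α κ P)
      fun h x a => (stateDistribution M.α κ P h.castSucc x * κ h x a) • E h x a := by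
  have hcone (h x a) := (hPE h x a).smul (mul_nonneg
    (stateDistribution_nonneg M.α_nonneg (fun h x => (hκ h x).1)
      (fun h x a => (hPE h x a).p_nonneg) h.castSucc x) ((hκ h x).1 a))
  exact ⟨fun h x a => (hcone h x a).p_nonneg, fun h x a => (hcone h x a).ε_nonneg,
    outflow_occupancy (fun h x => (hκ h x).2) hP, fun h x a => (hcone h x a).dev_pos,
    fun h x a => (hcone h x a).dev_neg, fun h i x a => (hcone h x a).conf i⟩

theorem exists_primalFeasible_primalObj_eq [Finite I] (hlast : β (Fin.last H) = 0)
    (hβ : ∀ h x, ∃ a, M.optimisticBackup h (β h.succ) x a = β h.castSucc x) :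
    ∃ q ε, M.PrimalFeasible q ε ∧ M.primalObj q = M.initialValue β := by
  classical
  choose π hπ using hβ
  choose P hP hmax using fun h x a => ConfidenceRegion.exists_dotProduct_eq_maxExpectation
    (M.distributions_nonempty h x a) (β h.succ)
  choose hmass E hE using hP
  have hfeasible := primalFeasible_occupancy (M := M) (κ := fun h x => Pi.single (π h x) 1)
    (fun h x => single_mem_stdSimplex ℝ (π h x)) hmass hE
  refine ⟨_, _, hfeasible, ?_⟩
  rw [primalObj_eq_of_flow hfeasible.flow hlast, add_eq_left]
  refine Finset.sum_eq_zero fun h _ => Finset.sum_eq_zero fun x _ =>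
    Finset.sum_eq_zero fun a _ => ?_
  rw [occupancy, smul_dotProduct]
  rcases eq_or_ne a (π h x) with rfl | ha
  · have htd : P h x (π h x) ⬝ᵥ M.temporalDifference β h x (π h x) = 0 := by
      rw [dotProduct_temporalDifference, hmass, hmax, ← hπ, optimisticBackup]
      ring
    rw [htd, smul_zero]
  · simp [ha]

theorem isGreatest_primalObj [Finite I] [Nonempty A] :
    IsGreatest {v : ℝ | ∃ q ε, M.PrimalFeasible q ε ∧ v = M.primalObj q}
      (M.initialValue M.optimisticValue) := by
  constructor
  · obtain ⟨q, ε, hq, hobj⟩ := exists_primalFeasible_primalObj_eq M.optimisticValue_last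
      M.exists_optimisticBackup_eq_optimisticValue
    exact ⟨q, ε, hq, hobj.symm⟩
  · rintro _ ⟨q, ε, hq, rfl⟩
    exact hq.primalObj_le_initialValue M.optimisticValue_last
      M.optimisticBackup_le_optimisticValue

end Primal

section Extraction

variable [Fintype A] {M} {q ε : Fin H → S → A → S → ℝ}

theorem PrimalFeasible.mass_pos_of_inducedPolicy_pos (hq : M.PrimalFeasible q ε) {h : Fin H}
    {x : S} {a : A} (ha : 0 < inducedPolicy q h x a) : 0 < ∑ y, q h x a y :=
  (Finset.sum_nonneg fun y _ => hq.q_nonneg h x a y).lt_of_ne fun hmass =>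
    ha.ne' (by rw [inducedPolicy, ← hmass, zero_div])

theorem exists_inducedPolicy_pos {h : Fin H} {x : S} (hx : 0 < outflow q h x) :
    ∃ a, 0 < inducedPolicy q h x a := by
  obtain ⟨a, -, ha⟩ := Finset.exists_lt_of_sum_lt (s := Finset.univ) (f := fun _ : A => (0 : ℝ))
    (g := fun a => ∑ y, q h x a y) (by simpa [outflow] using hx)
  exact ⟨a, div_pos ha hx⟩

variable [Finite I] [Nonempty A]

theorem PrimalOptimal.optimisticValue_eq_backup (hq : M.PrimalOptimal q ε) {h : Fin H} {x : S}
    {a : A} (ha : 0 < inducedPolicy q h x a) :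
    M.optimisticValue h.castSucc x =
      M.backup h x a (M.optimisticBonus h x a) (M.optimisticValue h.succ) := by
  obtain ⟨q', ε', hq', hobj⟩ := (isGreatest_primalObj (M := M)).1
  rw [optimisticBonus, backup_bonus]
  exact hq.1.eq_optimisticBackup M.optimisticValue_last M.optimisticBackup_le_optimisticValue
    (hobj.trans_le (hq.2 q' ε' hq')) (hq.1.mass_pos_of_inducedPolicy_pos ha)

theorem PrimalOptimal.exists_isExtracted (hq : M.PrimalOptimal q ε) :
    ∃ π : Fin H → S → A, IsExtracted q π ∧ ∀ h x, M.optimisticValue h.castSucc x =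
      M.backup h x (π h x) (M.optimisticBonus h x (π h x)) (M.optimisticValue h.succ) := by
  have haction (h : Fin H) (x : S) : ∃ a, (0 < outflow q h x → 0 < inducedPolicy q h x a) ∧
      M.optimisticValue h.castSucc x =
        M.backup h x a (M.optimisticBonus h x a) (M.optimisticValue h.succ) := by
    by_cases hx : 0 < outflow q h x
    · obtain ⟨a, ha⟩ := exists_inducedPolicy_pos hx
      exact ⟨a, fun _ => ha, hq.optimisticValue_eq_backup ha⟩
    · obtain ⟨a, ha⟩ := M.exists_optimisticBackup_eq_optimisticValue h x
      exact ⟨a, fun hx' => absurd hx' hx, by rw [optimisticBonus, backup_bonus, ha]⟩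
  choose π hextracted hvalue using haction
  exact ⟨π, hextracted, hvalue⟩

end Extraction

end OptimisticModel

/-- The dual of the primal optimistic linear program is an optimistic Bellman linear program. -/
theorem mainTheorem1 {S A I : Type*} [Fintype S] [Fintype A] [Nonempty A] [Fintype I] {H : ℕ}
    (M : OptimisticModel S A I H) :
    ∃ (CB : Fin H → S → A → ℝ) (βs : Fin (H + 1) → S → ℝ)
      (B : Fin H → (S → ℝ) → S → A → ℝ),
      -- the bonus is nonnegative, and is a function of the next-stage solution
      (∀ h x a, 0 ≤ CB h x a) ∧
      (∀ h v x a, 0 ≤ B h v x a) ∧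
      (∀ h x a, CB h x a = B h (βs h.succ) x a) ∧
      -- eliminating the other multipliers from the dual leaves the Bellman program in `β`
      (∀ β : Fin (H + 1) → S → ℝ, (∀ x, β (Fin.last H) x = 0) → ∀ v : ℝ,
        (∃ m : Multipliers S A I H, (∀ h x, m.β h x = β h.castSucc x) ∧ M.IsDualValue m v) ↔
          (v = M.initialValue β ∧
            ∀ h x a, M.backup h x a (B h (β h.succ) x a) (β h.succ) ≤ β h.castSucc x)) ∧
      -- `βs` is the optimal solution of the Bellman program with bonus `CB`:
      -- the componentwise least feasible point
      M.BellmanFeasible CB βs ∧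
      (∀ β, M.BellmanFeasible CB β → ∀ h x, βs h x ≤ β h x) ∧
      IsLeast {v : ℝ | ∃ β, M.BellmanFeasible CB β ∧ v = M.initialValue β} (M.initialValue βs) ∧
      -- `βs` is also (the `β`-part of) an optimal solution of the dual program
      (∃ m : Multipliers S A I H, (∀ h x, m.β h x = βs h.castSucc x) ∧
        M.IsDualValue m (M.initialValue βs)) ∧
      IsLeast {v : ℝ | ∃ m : Multipliers S A I H, M.IsDualValue m v} (M.initialValue βs) ∧
      -- strong duality with the primal program
      IsGreatest {v : ℝ | ∃ q ε, M.PrimalFeasible q ε ∧ v = M.primalObj q}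
        (M.initialValue βs) ∧
      -- the policy extracted from any primal optimum attains equality
      (∀ q ε, M.PrimalOptimal q ε →
        (∀ h x a, 0 < OptimisticModel.inducedPolicy q h x a →
          βs h.castSucc x = M.backup h x a (CB h x a) (βs h.succ)) ∧
        ∃ π : Fin H → S → A, OptimisticModel.IsExtracted q π ∧
          ∀ h x, βs h.castSucc x = M.backup h x (π h x) (CB h x (π h x)) (βs h.succ)) ∧
      -- optimism and boundedness
      (∀ P : Fin H → S → A → S → ℝ, IsTransition P → M.InConfidenceSet P →
        ∀ (h : Fin (H + 1)) (x : S),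
          optimalValue P M.r h x ≤ βs h x ∧ βs h x ≤ (H : ℝ) - ((h : ℕ) : ℝ)) := by
  refine ⟨M.optimisticBonus, M.optimisticValue, M.bonus, fun h x a => M.bonus_nonneg h _ x a,
    M.bonus_nonneg, fun _ _ _ => rfl, fun β hβ v => ?_, M.bellmanFeasible_optimisticValue,
    fun β hβ => M.optimisticValue_le_of_bellmanFeasible hβ, M.isLeast_bellmanValue, ?_,
    OptimisticModel.isLeast_dualValue, OptimisticModel.isGreatest_primalObj, fun q ε hq =>
      ⟨fun _ _ _ => hq.optimisticValue_eq_backup, hq.exists_isExtracted⟩,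
    fun P hP hPM h x =>
      ⟨M.optimalValue_le_optimisticValue hP hPM h x, M.optimisticValue_le_horizon h x⟩⟩
  · simpa only [funext_iff, M.backup_bonus] using
      OptimisticModel.exists_isDualValue_iff (funext hβ)
  · simpa only [funext_iff] using OptimisticModel.exists_isDualValue_optimisticValue
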